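/- Consider two saturated (always non-empty) queues $i\in\{1,2\}$ and one server in slotted time $t=0,1,2,\dots$. In slot $t$ the server is present at queue $m(t)\in\{1,2\}$, and the channel of queue $i$ is ON ($C_i(t)=1$) or OFF ($C_i(t)=0$). The two channels are independent symmetric Gilbert–Elliott chains: in each slot $C_i$ changes its state with probability $\epsilon$ and keeps it with probability $1-\epsilon$, where $0<\epsilon\le \tfrac12$. In every slot the server observes $(m(t),C_1(t),C_2(t))$ and takes an action $a_t\in\{0,1\}$: if $a_t=1$ it stays, so that $m(t+1)=m(t)$, and if $a_t=0$ it switches, so that $m(t+1)$ is the other queue. One packet leaves queue $i$ in slot $t$ if $m(t)=i$, $a_t=1$ and $C_i(t)=1$, and none otherwise; let $r_i(t)\in\{0,1\}$ denote this number of departures. A policy chooses $a_t$ at random with a probability that may depend on $t$ and on all states and actions observed so far (history dependent, randomized, non-stationary). Let $\mathbf\Lambda_s$ be the set of all pairs $(\lambda_1,\lambda_2)$ for which there is a policy with $$\lim_{K\to\infty}\frac1K\,\mathbb E\Big[\sum_{t=1}^{K} r_i(t)\Big]=\lambda_i,\qquad i=1,2 .$$ Put $\epsilon_c=1-\sqrt2/2$.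 Then, for every distribution of the initial state $(m(0),C_1(0),C_2(0))$, the following holds. If $\epsilon<\epsilon_c$, then $\mathbf\Lambda_s$ is the set of all $\lambda_1\ge0$, $\lambda_2\ge0$ with $$\epsilon\lambda_1+(1-\epsilon)^2\lambda_2\le\tfrac{(1-\epsilon)^2}{2},\qquad (1-\epsilon)\lambda_1+(1+\epsilon-\epsilon^2)\lambda_2\le\tfrac34-\tfrac{\epsilon}{2},\qquad \lambda_1+\lambda_2\le\tfrac34-\tfrac{\epsilon}{2},$$ $$(1+\epsilon-\epsilon^2)\lambda_1+(1-\epsilon)\lambda_2\le\tfrac34-\tfrac{\epsilon}{2},\qquad (1-\epsilon)^2\lambda_1+\epsilon\lambda_2\le\tfrac{(1-\epsilon)^2}{2}.$$ If $\epsilon\ge\epsilon_c$, then $\mathbf\Lambda_s$ is the set of all $\lambda_1\ge0$, $\lambda_2\ge0$ with $$\lambda_1+(1-\epsilon)(3-2\epsilon)\lambda_2\le\tfrac{(1-\epsilon)(3-2\epsilon)}{2},\qquad \lambda_1+\lambda_2\le\tfrac34-\tfrac{\epsilon}{2},\qquad (1-\epsilon)(3-2\epsilon)\lambda_1+\lambda_2\le\tfrac{(1-\epsilon)(3-2\epsilon)}{2}.$$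 -/

import Mathlib

/-!
# Two saturated queues, symmetric Gilbert-Elliott channels, one-slot switchover

The two queues are indexed by `Fin 2`. The state in a slot is `(m, C)`, where `m` is the queue at
which the server is present and `C i` says whether the channel of queue `i` is ON (`true`) or
OFF (`false`). An action is `true` (stay with the current queue) or `false` (switch).
-/

namespace SwitchoverQueues

/-- The state `(m(t), C₁(t), C₂(t))` of the saturated system: 8 states. -/
abbrev State : Type := Fin 2 × (Fin 2 → Bool)

/-- The action of a slot: `true` means stay, `false` means switch to the other queue. -/
abbrev Action : Type := Bool

/-- The queue at which the server is present in the next slot (`Fin.rev` exchanges the two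
queues). -/
def nextServer (m : Fin 2) (a : Action) : Fin 2 :=
  if a = true then m else m.rev

/-- One step of the symmetric Gilbert-Elliott channel: it changes between ON and OFF with
probability `ε`. -/
noncomputable def channelProb (ε : ℝ) (c c' : Bool) : ℝ :=
  if c' = c then 1 - ε else ε

/-- The transition probability `P(s' | s, a)`: the server moves according to the action, and the
two channels evolve independently. -/
noncomputable def transProb (ε : ℝ) (s : State) (a : Action) (s' : State) : ℝ :=
  if s'.1 = nextServer s.1 a then ∏ i, channelProb ε (s.2 i) (s'.2 i) else 0

/-- The number of packets that leave queue `i` in a slot with state `s` and action `a`: one packet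
if the server is at queue `i`, stays there, and the channel of queue `i` is ON. -/
noncomputable def reward (i : Fin 2) (s : State) (a : Action) : ℝ :=
  if s.1 = i ∧ a = true ∧ s.2 i = true then 1 else 0

/-- A policy, possibly history dependent, randomized and non-stationary. `prob h s a` is the
probability of taking action `a` in the current state `s` when `h` lists the states and actions of
all earlier slots, the most recent one first (so the slot number is the length of `h`). -/
structure Policy where
  prob : List (State × Action) → State → Action → ℝ
  prob_nonneg : ∀ h s a, 0 ≤ prob h s a
  prob_sum : ∀ h s, ∑ a, prob h s a = 1

/-- The probability, under the policy `π` and the initial state distribution `μ`, that the states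
and actions of the slots before the current one are those of `h` (most recent first) and the
current state is `s`. -/
noncomputable def pathProb (ε : ℝ) (μ : State → ℝ) (π : Policy) :
    List (State × Action) → State → ℝ
  | [], s => μ s
  | (s₀, a₀) :: h, s => pathProb ε μ π h s₀ * π.prob h s₀ a₀ * transProb ε s₀ a₀ s

/-- The expected number of departures from queue `i` in slot `t`, `E[r_i(s_t, a_t)]`. -/
noncomputable def expectedReward (ε : ℝ) (μ : State → ℝ) (π : Policy) (i : Fin 2) (t : ℕ) : ℝ :=
  ∑ h : List.Vector (State × Action) t, ∑ s, ∑ a,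
    pathProb ε μ π h.toList s * π.prob h.toList s a * reward i s a

/-- `r` is the pair of time average expected departure rates of the policy `π`: for both queues
the limit exists and equals `r i`. -/
def HasDepartureRates (ε : ℝ) (μ : State → ℝ) (π : Policy) (r : Fin 2 → ℝ) : Prop :=
  ∀ i, Filter.Tendsto
    (fun K : ℕ => (1 / (K : ℝ)) * ∑ t ∈ Finset.Icc 1 K, expectedReward ε μ π i t)
    Filter.atTop (nhds (r i))

/-- The rate region `Λ_s`: all pairs of time average expected departure rates that can be obtained
in the saturated system, started from `μ`, under all policies. -/
def rateRegion (ε : ℝ) (μ : State → ℝ) : Set (Fin 2 → ℝ) :=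
  {r | ∃ π : Policy, HasDepartureRates ε μ π r}

/-- The critical transition probability `ε_c`. -/
noncomputable def criticalEps : ℝ := 1 - √2 / 2

end SwitchoverQueues

namespace SwitchoverQueues

open Finset Filter Topology

/-! ### Occupation measures -/

/-! Only the state-action distribution of each slot matters (`mem_rateRegion_iff`), so the rate
region is compared with the polygon `stationaryRates` of rates of invariant distributions.

Upper bounds: a function `H` satisfying the average-reward optimality inequality for a weighted
reward with gain `g` makes the expected reward telescope, so the weighted rate is at most `g`
(`rate_le_of_bias`). Each oblique side of the region has such a function (`isBias_sum`,
`isBias_steep`, `isBias_steepest`, `isBias_critical`).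

Attainment: an invariant distribution is reached from any initial law by absorbing mass into it at a
geometric rate (`stationaryRates_subset_rateRegion`). By convexity only vertices are needed: the
origin, staying forever, and the `greedy` and `lazy` policies favouring either queue.

The threshold: with the favoured queue as first coordinate, the greedy vertex lies strictly beyond
the line through the staying and lazy vertices exactly when 1 - 4ε + 2ε² > 0, that is, for ε < ε_c
in the given range. Otherwise this vertex disappears and two sides merge into one. -/

theorem sum_vector_succ {α : Type*} [Fintype α] (t : ℕ) (f : List.Vector α (t + 1) → ℝ) :
    ∑ v, f v = ∑ v : List.Vector α t, ∑ x : α, f (x ::ᵥ v) := by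
  rw [← Fintype.sum_prod_type' (f := fun (v : List.Vector α t) (x : α) => f (x ::ᵥ v))]
  refine (Fintype.sum_bijective (fun q : List.Vector α t × α => q.2 ::ᵥ q.1) ⟨?_, ?_⟩ _ _
    (fun _ => rfl)).symm
  · rintro ⟨v, x⟩ ⟨w, y⟩ h
    have h1 := congrArg List.Vector.head h
    have h2 := congrArg List.Vector.tail h
    simp only [List.Vector.head_cons, List.Vector.tail_cons] at h1 h2
    rw [h1, h2]
  · intro v
    exact ⟨(v.tail, v.head), v.cons_head_tail⟩

/-- The distributions `y t` of the state-action pairs of the slots `t`, started from `μ`. -/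
structure IsOccupation (ε : ℝ) (μ : State → ℝ) (y : ℕ → State → Action → ℝ) : Prop where
  nonneg : ∀ t s a, 0 ≤ y t s a
  start : ∀ s, ∑ a, y 0 s a = μ s
  flow : ∀ t s', ∑ a, y (t + 1) s' a = ∑ s, ∑ a, y t s a * transProb ε s a s'

/-- The mean number of departures from queue `i` under a state-action distribution. -/
noncomputable def meanReward (x : State → Action → ℝ) (i : Fin 2) : ℝ :=
  ∑ s, ∑ a, x s a * reward i s a

/-- The state-action distribution of slot `t` under a policy. -/
noncomputable def occupation (ε : ℝ) (μ : State → ℝ) (π : Policy) (t : ℕ) (s : State)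
    (a : Action) : ℝ :=
  ∑ h : List.Vector (State × Action) t, pathProb ε μ π h.toList s * π.prob h.toList s a

theorem expectedReward_eq (ε : ℝ) (μ : State → ℝ) (π : Policy) (i : Fin 2) (t : ℕ) :
    expectedReward ε μ π i t = meanReward (occupation ε μ π t) i := by
  unfold expectedReward meanReward occupation
  simp_rw [Finset.sum_mul]
  rw [Finset.sum_comm]
  refine Finset.sum_congr rfl fun s _ => ?_
  rw [Finset.sum_comm]

theorem channelProb_nonneg {ε : ℝ} (h0 : 0 ≤ ε) (h1 : ε ≤ 1) (c c' : Bool) :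
    0 ≤ channelProb ε c c' := by
  unfold channelProb
  split_ifs <;> linarith

theorem transProb_nonneg {ε : ℝ} (h0 : 0 ≤ ε) (h1 : ε ≤ 1) (s : State) (a : Action)
    (s' : State) : 0 ≤ transProb ε s a s' := by
  unfold transProb
  split_ifs
  · exact Finset.prod_nonneg fun i _ => channelProb_nonneg h0 h1 _ _
  · exact le_rfl

theorem sum_transProb (ε : ℝ) (s : State) (a : Action) : ∑ s', transProb ε s a s' = 1 := by
  have h : ∀ c, ∑ c', channelProb ε c c' = 1 := by
    intro c
    cases c <;> simp [channelProb]
  simp only [transProb, Fintype.sum_prod_type]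
  rw [Finset.sum_eq_single (nextServer s.1 a)]
  · simp only [if_true]
    rw [← Fintype.prod_sum]
    simp only [h, Finset.prod_const_one]
  · intro m _ hm
    simp [hm]
  · simp

theorem pathProb_nonneg {ε : ℝ} (h0 : 0 ≤ ε) (h1 : ε ≤ 1) {μ : State → ℝ}
    (hμ : ∀ s, 0 ≤ μ s) (π : Policy) (h : List (State × Action)) (s : State) :
    0 ≤ pathProb ε μ π h s := by
  induction h generalizing s with
  | nil => exact hμ s
  | cons q h ih =>
    exact mul_nonneg (mul_nonneg (ih _) (π.prob_nonneg _ _ _)) (transProb_nonneg h0 h1 _ _ _)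

theorem sum_pathProb_succ (ε : ℝ) (μ : State → ℝ) (π : Policy) (t : ℕ) (s' : State) :
    ∑ h : List.Vector (State × Action) (t + 1), pathProb ε μ π h.toList s' =
      ∑ s, ∑ a, occupation ε μ π t s a * transProb ε s a s' := by
  rw [sum_vector_succ]
  simp only [List.Vector.toList_cons, occupation, Finset.sum_mul]
  rw [Finset.sum_comm, Fintype.sum_prod_type]
  refine Finset.sum_congr rfl fun s _ => Finset.sum_congr rfl fun a _ => ?_
  simp only [pathProb]

theorem sum_occupation (ε : ℝ) (μ : State → ℝ) (π : Policy) (t : ℕ) (s : State) :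
    ∑ a, occupation ε μ π t s a =
      ∑ h : List.Vector (State × Action) t, pathProb ε μ π h.toList s := by
  unfold occupation
  rw [Finset.sum_comm]
  simp_rw [← Finset.mul_sum, π.prob_sum, mul_one]

theorem sum_pathProb_zero (ε : ℝ) (μ : State → ℝ) (π : Policy) (s : State) :
    ∑ h : List.Vector (State × Action) 0, pathProb ε μ π h.toList s = μ s := by
  rw [Fintype.sum_eq_single List.Vector.nil fun v hv => absurd v.eq_nil hv]
  rfl

theorem isOccupation_occupation {ε : ℝ} (h0 : 0 ≤ ε) (h1 : ε ≤ 1) {μ : State → ℝ}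
    (hμ : ∀ s, 0 ≤ μ s) (π : Policy) : IsOccupation ε μ (occupation ε μ π) where
  nonneg t s a := Finset.sum_nonneg fun h _ =>
    mul_nonneg (pathProb_nonneg h0 h1 hμ π _ _) (π.prob_nonneg _ _ _)
  start s := by rw [sum_occupation, sum_pathProb_zero]
  flow t s' := by rw [sum_occupation, sum_pathProb_succ]

/-- The Markov policy whose action probabilities are the conditional ones of `y`. -/
noncomputable def markovPolicy (y : ℕ → State → Action → ℝ) (hy : ∀ t s a, 0 ≤ y t s a) :
    Policy where
  -- In a state of mass zero the conditional law is undefined; the uniform value is arbitrary.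
  prob h s a := if ∑ b, y h.length s b = 0 then 1 / 2 else
    y h.length s a / ∑ b, y h.length s b
  prob_nonneg h s a := by
    split_ifs
    · norm_num
    · exact div_nonneg (hy _ _ _) (Finset.sum_nonneg fun b _ => hy _ _ _)
  prob_sum h s := by
    split_ifs with h0
    · simp
    · rw [← Finset.sum_div, div_self h0]

theorem occupation_markovPolicy {ε : ℝ} {μ : State → ℝ} {y : ℕ → State → Action → ℝ}
    (hy : IsOccupation ε μ y) (t : ℕ) :
    occupation ε μ (markovPolicy y hy.nonneg) t = y t := by
  -- Agreement of the state marginals forces agreement of the state-action laws, since the action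
  -- probabilities are the conditional ones.
  have key : ∀ t, (∀ s, ∑ h : List.Vector (State × Action) t,
      pathProb ε μ (markovPolicy y hy.nonneg) h.toList s = ∑ a, y t s a) →
      occupation ε μ (markovPolicy y hy.nonneg) t = y t := by
    intro t ht
    funext s a
    unfold occupation
    simp only [markovPolicy, List.Vector.toList_length]
    rw [← Finset.sum_mul]
    have := ht s
    simp only [markovPolicy] at this
    rw [this]
    split_ifs with h0
    · rw [h0, zero_mul]
      exact ((Finset.sum_eq_zero_iff_of_nonneg fun b _ => hy.nonneg t s b).1 h0 a
        (Finset.mem_univ a)).symm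
    · rw [mul_div_cancel₀ _ h0]
  induction t with
  | zero =>
    refine key 0 fun s => ?_
    rw [sum_pathProb_zero, hy.start]
  | succ t ih =>
    refine key (t + 1) fun s => ?_
    rw [sum_pathProb_succ, ih, hy.flow]

/-- Expected rewards see a policy only through its one-slot distributions, and any sequence of these
obeying the flow equations is realised by a Markov policy. -/
theorem mem_rateRegion_iff {ε : ℝ} (h0 : 0 ≤ ε) (h1 : ε ≤ 1) {μ : State → ℝ}
    (hμ : ∀ s, 0 ≤ μ s) (r : Fin 2 → ℝ) :
    r ∈ rateRegion ε μ ↔ ∃ y, IsOccupation ε μ y ∧ ∀ i, Tendsto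
      (fun K : ℕ => (1 / (K : ℝ)) * ∑ t ∈ Finset.Icc 1 K, meanReward (y t) i) atTop
      (𝓝 (r i)) := by
  constructor
  · rintro ⟨π, hπ⟩
    refine ⟨_, isOccupation_occupation h0 h1 hμ π, fun i => ?_⟩
    simpa only [expectedReward_eq] using hπ i
  · rintro ⟨y, hy, hr⟩
    refine ⟨markovPolicy y hy.nonneg, fun i => ?_⟩
    simpa only [expectedReward_eq, occupation_markovPolicy hy] using hr i

/-! ### Upper bounds from bias functions -/

theorem IsOccupation.sum_eq_one {ε : ℝ} {μ : State → ℝ} {y : ℕ → State → Action → ℝ}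
    (hy : IsOccupation ε μ y) (hμ : ∑ s, μ s = 1) (t : ℕ) : ∑ s, ∑ a, y t s a = 1 := by
  induction t with
  | zero => simp_rw [hy.start, hμ]
  | succ t ih =>
    simp_rw [hy.flow]
    rw [Finset.sum_comm]
    rw [← ih]
    refine Finset.sum_congr rfl fun s _ => ?_
    rw [Finset.sum_comm]
    simp_rw [← Finset.mul_sum, sum_transProb, mul_one]

theorem IsOccupation.drift {ε : ℝ} {μ : State → ℝ} {y : ℕ → State → Action → ℝ}
    (hy : IsOccupation ε μ y) (H : State → ℝ) (t : ℕ) :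
    ∑ s, (∑ a, y (t + 1) s a) * H s =
      ∑ s, ∑ a, y t s a * ∑ s', transProb ε s a s' * H s' := by
  simp_rw [hy.flow, Finset.sum_mul, Finset.mul_sum]
  rw [Finset.sum_comm]
  refine Finset.sum_congr rfl fun s _ => ?_
  rw [Finset.sum_comm]
  simp only [mul_assoc]

/-- A bias function `H` (scaled by `w`) certifies a bound on weighted departure rates. -/
theorem rate_le_of_bias {ε : ℝ} {μ : State → ℝ} (hμ : ∑ s, μ s = 1)
    {y : ℕ → State → Action → ℝ} (hy : IsOccupation ε μ y) {r : Fin 2 → ℝ}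
    (hr : ∀ i, Tendsto (fun K : ℕ => (1 / (K : ℝ)) * ∑ t ∈ Finset.Icc 1 K, meanReward (y t) i)
      atTop (𝓝 (r i)))
    (i j : Fin 2) (α β g w : ℝ) (hw : 0 < w) (H : State → ℝ)
    (hH : ∀ s a, w * (α * reward i s a + β * reward j s a - g)
      + ∑ s', transProb ε s a s' * H s' ≤ H s) :
    α * r i + β * r j ≤ g := by
  -- `V t` is the expected bias in slot `t`; it is bounded, so the telescoped sum costs only O(1/K)
  -- in the average.
  set V : ℕ → ℝ := fun t => ∑ s, (∑ a, y t s a) * H s with hV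
  have hstep : ∀ t, w * (α * meanReward (y t) i + β * meanReward (y t) j - g) ≤
      V t - V (t + 1) := by
    intro t
    have h1 : ∑ s, ∑ a, y t s a * (w * (α * reward i s a + β * reward j s a - g)
        + ∑ s', transProb ε s a s' * H s') ≤ ∑ s, ∑ a, y t s a * H s :=
      Finset.sum_le_sum fun s _ => Finset.sum_le_sum fun a _ =>
        mul_le_mul_of_nonneg_left (hH s a) (hy.nonneg t s a)
    have h2 : ∑ s, ∑ a, y t s a * (w * (α * reward i s a + β * reward j s a - g)
        + ∑ s', transProb ε s a s' * H s') =
        w * (α * meanReward (y t) i + β * meanReward (y t) j - g) + V (t + 1) := by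
      rw [hV]
      simp only []
      rw [hy.drift]
      have h3 := hy.sum_eq_one hμ t
      calc _ = w * (α * meanReward (y t) i + β * meanReward (y t) j
            - g * ∑ s, ∑ a, y t s a) +
            ∑ s, ∑ a, y t s a * ∑ s', transProb ε s a s' * H s' := by
            simp only [meanReward, Finset.mul_sum, ← Finset.sum_add_distrib,
              ← Finset.sum_sub_distrib]
            refine Finset.sum_congr rfl fun s _ => Finset.sum_congr rfl fun a _ => ?_
            rw [mul_add, Finset.mul_sum]
            ring
        _ = _ := by rw [h3, mul_one]
    have h4 : ∑ s, ∑ a, y t s a * H s = V t := by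
      simp only [hV, Finset.sum_mul]
    linarith
  obtain ⟨M, hM⟩ : ∃ M, ∀ t, |V t| ≤ M := by
    refine ⟨∑ s, |H s|, fun t => (Finset.abs_sum_le_sum_abs _ _).trans
      (Finset.sum_le_sum fun s _ => ?_)⟩
    have hn : ∀ s, 0 ≤ ∑ a, y t s a := fun s => Finset.sum_nonneg fun a _ => hy.nonneg t s a
    have h5 : ∑ a, y t s a ≤ 1 := by
      rw [← hy.sum_eq_one hμ t]
      exact Finset.single_le_sum (f := fun s => ∑ a, y t s a) (fun s _ => hn s)
        (Finset.mem_univ s)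
    rw [abs_mul, abs_of_nonneg (hn s)]
    exact mul_le_of_le_one_left (abs_nonneg _) h5
  have hsum : ∀ K : ℕ, w * (α * ∑ t ∈ Finset.Icc 1 K, meanReward (y t) i
      + β * ∑ t ∈ Finset.Icc 1 K, meanReward (y t) j - K * g) ≤ V 1 - V (K + 1) := by
    intro K
    induction K with
    | zero => simp
    | succ K ih =>
      rw [Finset.sum_Icc_succ_top (by omega), Finset.sum_Icc_succ_top (by omega)]
      have := hstep (K + 1)
      push_cast
      linarith
  have hlim : Tendsto (fun K : ℕ => g + (2 * M / w) * (1 / (K : ℝ))) atTop (𝓝 g) := by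
    simpa using (tendsto_const_nhds (x := g)).add
      ((tendsto_const_nhds (x := 2 * M / w)).mul tendsto_one_div_atTop_nhds_zero_nat)
  refine le_of_tendsto_of_tendsto (((hr i).const_mul α).add ((hr j).const_mul β)) hlim ?_
  filter_upwards [eventually_gt_atTop 0] with K hK
  have hK' : (0 : ℝ) < K := by exact_mod_cast hK
  have h6 := hsum K
  have h7 : V 1 - V (K + 1) ≤ 2 * M := by
    have := abs_le.1 (hM 1)
    have := abs_le.1 (hM (K + 1))
    linarith
  have h8 : α * ∑ t ∈ Finset.Icc 1 K, meanReward (y t) i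
      + β * ∑ t ∈ Finset.Icc 1 K, meanReward (y t) j - K * g ≤ 2 * M / w := by
    rw [le_div_iff₀ hw]
    linarith
  have h9 := mul_le_mul_of_nonneg_left h8 (one_div_nonneg.2 hK'.le)
  have h10 : 1 / (K : ℝ) * (K * g) = g := by field_simp
  rw [mul_sub, h10] at h9
  linarith

theorem rate_nonneg {ε : ℝ} {μ : State → ℝ} {y : ℕ → State → Action → ℝ}
    (hy : IsOccupation ε μ y) {r : Fin 2 → ℝ}
    (hr : ∀ i, Tendsto (fun K : ℕ => (1 / (K : ℝ)) * ∑ t ∈ Finset.Icc 1 K, meanReward (y t) i)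
      atTop (𝓝 (r i))) (i : Fin 2) : 0 ≤ r i := by
  refine ge_of_tendsto' (hr i) fun K => mul_nonneg (by positivity) ?_
  refine Finset.sum_nonneg fun t _ => Finset.sum_nonneg fun s _ => Finset.sum_nonneg fun a _ =>
    mul_nonneg (hy.nonneg t s a) ?_
  unfold reward
  split_ifs <;> norm_num

/-! ### Achievability of stationary occupation measures -/

/-- A state-action distribution that is preserved by the dynamics. -/
structure IsStationary (ε : ℝ) (x : State → Action → ℝ) : Prop where
  nonneg : ∀ s a, 0 ≤ x s a
  sum_eq_one : ∑ s, ∑ a, x s a = 1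
  balance : ∀ s', ∑ a, x s' a = ∑ s, ∑ a, x s a * transProb ε s a s'

/-- The departure rates of stationary state-action distributions. -/
def stationaryRates (ε : ℝ) : Set (Fin 2 → ℝ) :=
  {r | ∃ x, IsStationary ε x ∧ meanReward x = r}

theorem convex_stationaryRates (ε : ℝ) : Convex ℝ (stationaryRates ε) := by
  rintro _ ⟨x, hx, rfl⟩ _ ⟨z, hz, rfl⟩ a b ha hb hab
  refine ⟨fun s u => a * x s u + b * z s u, ⟨fun s u => ?_, ?_, fun s' => ?_⟩, ?_⟩
  · exact add_nonneg (mul_nonneg ha (hx.nonneg s u)) (mul_nonneg hb (hz.nonneg s u))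
  · simp_rw [Finset.sum_add_distrib, ← Finset.mul_sum, hx.sum_eq_one, hz.sum_eq_one]
    linarith
  · simp_rw [add_mul, Finset.sum_add_distrib, mul_assoc, ← Finset.mul_sum, hx.balance,
      hz.balance]
  · funext i
    simp only [meanReward, add_mul, Finset.sum_add_distrib, mul_assoc, ← Finset.mul_sum,
      Pi.add_apply, Pi.smul_apply, smul_eq_mul]

/-- A Doeblin minorisation: some action takes the server to the required queue, and each channel
makes the required move with probability at least ε because ε ≤ 1 - ε. -/
theorem sq_le_sum_transProb {ε : ℝ} (h0 : 0 < ε) (h1 : ε ≤ 1 / 2) (s s' : State) :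
    ε ^ 2 ≤ ∑ a, transProb ε s a s' := by
  have hp : ε ^ 2 ≤ ∏ i, channelProb ε (s.2 i) (s'.2 i) := by
    rw [show ε ^ 2 = ∏ _i : Fin 2, ε by simp]
    refine Finset.prod_le_prod (fun _ _ => h0.le) fun i _ => ?_
    unfold channelProb
    split_ifs <;> linarith
  obtain ⟨a, ha⟩ : ∃ a, s'.1 = nextServer s.1 a := by
    have : ∀ m m' : Fin 2, ∃ a, m' = nextServer m a := by
      unfold nextServer
      decide
    exact this _ _
  refine hp.trans (le_of_eq_of_le ?_ (Finset.single_le_sum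
    (fun a _ => transProb_nonneg h0.le (by linarith) s a s') (Finset.mem_univ a)))
  rw [transProb, if_pos ha]

/-- The part of the state distribution in slot `t` that has not been absorbed into the stationary
state distribution `z` when uniformly random actions are taken until absorption. -/
noncomputable def remainder (ε c : ℝ) (μ z : State → ℝ) : ℕ → State → ℝ
  | 0 => μ
  | t + 1 => fun s' => ∑ s, remainder ε c μ z t s * (∑ a, transProb ε s a s' / 2 - c * z s')

theorem sum_remainder {ε c : ℝ} {μ z : State → ℝ} (hμ : ∑ s, μ s = 1) (hz : ∑ s, z s = 1)
    (t : ℕ) : ∑ s, remainder ε c μ z t s = (1 - c) ^ t := by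
  induction t with
  | zero => simpa [remainder] using hμ
  | succ t ih =>
    simp only [remainder]
    rw [Finset.sum_comm]
    simp_rw [← Finset.mul_sum, Finset.sum_sub_distrib]
    have h : ∀ s : State, ∑ s', ∑ a, transProb ε s a s' / 2 = 1 := by
      intro s
      rw [Finset.sum_comm]
      simp_rw [← Finset.sum_div, sum_transProb]
      simp
    simp_rw [h, ← Finset.mul_sum, hz, mul_one, ← Finset.sum_mul, ih, pow_succ]

theorem stationaryRates_subset_rateRegion {ε : ℝ} (hε0 : 0 < ε) (hε : ε ≤ 1 / 2)
    {μ : State → ℝ} (hμ : μ ∈ stdSimplex ℝ State) : stationaryRates ε ⊆ rateRegion ε μ := by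
  rintro r ⟨x, hx, rfl⟩
  rw [mem_rateRegion_iff hε0.le (by linarith) hμ.1]
  -- Under uniform actions every state has one-step probability at least ε²/2, so a fraction `c` of
  -- the remaining mass can be absorbed into `z` in each slot.
  set c : ℝ := ε ^ 2 / 2 with hc
  have hc0 : 0 < c := by positivity
  have hc1 : c < 1 := by rw [hc]; nlinarith
  set z : State → ℝ := fun s => ∑ a, x s a with hz
  have hz0 : ∀ s, 0 ≤ z s := fun s => Finset.sum_nonneg fun a _ => hx.nonneg s a
  have hz1 : ∑ s, z s = 1 := hx.sum_eq_one
  have hzle : ∀ s, z s ≤ 1 := fun s => by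
    rw [← hz1]; exact Finset.single_le_sum (fun s _ => hz0 s) (Finset.mem_univ s)
  set d := remainder ε c μ z with hd
  have hd0 : ∀ t s, 0 ≤ d t s := by
    intro t
    induction t with
    | zero => exact hμ.1
    | succ t ih =>
      intro s'
      refine Finset.sum_nonneg fun s _ => mul_nonneg (ih s) ?_
      have h1 := sq_le_sum_transProb hε0 hε s s'
      have h2 := mul_le_mul_of_nonneg_left (hzle s') hc0.le
      rw [← Finset.sum_div]
      linarith
  have hds : ∀ t, ∑ s, d t s = (1 - c) ^ t := sum_remainder hμ.2 hz1
  have hpow : ∀ t : ℕ, (1 - c) ^ t ≤ 1 := fun t => pow_le_one₀ (by linarith) (by linarith)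
  -- Absorbed mass follows `x`, the rest acts uniformly. This also serves the policy that never
  -- leaves a queue, whose own chain need not reach that queue.
  refine ⟨fun t s a => (1 - (1 - c) ^ t) * x s a + d t s / 2, ⟨fun t s a => ?_, fun s => ?_,
    fun t s' => ?_⟩, fun i => ?_⟩
  · exact add_nonneg (mul_nonneg (by linarith [hpow t]) (hx.nonneg s a))
      (by linarith [hd0 t s])
  · simp only [hd, remainder, pow_zero, sub_self, zero_mul, zero_add, Fintype.sum_bool]
    ring
  · simp_rw [add_mul, Finset.sum_add_distrib, mul_assoc, ← Finset.mul_sum, ← hx.balance]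
    have h1 : d (t + 1) s' = ∑ s, d t s * ∑ a, transProb ε s a s' / 2
        - (1 - c) ^ t * (c * z s') := by
      rw [← hds t, Finset.sum_mul, ← Finset.sum_sub_distrib]
      simp only [hd, remainder, mul_sub]
    have h2 : ∑ s, ∑ a, d t s / 2 * transProb ε s a s' =
        ∑ s, d t s * ∑ a, transProb ε s a s' / 2 := by
      refine Finset.sum_congr rfl fun s _ => ?_
      rw [Finset.mul_sum]
      refine Finset.sum_congr rfl fun a _ => ?_
      ring
    have h3 : ∑ _a : Action, d (t + 1) s' / 2 = d (t + 1) s' := by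
      rw [Fintype.sum_bool, add_halves]
    simp_rw [← Finset.mul_sum] at h2
    rw [h3, h1, h2, pow_succ]
    simp only [hz]
    ring
  · have hlim : Tendsto (fun t => meanReward
        (fun s a => (1 - (1 - c) ^ t) * x s a + d t s / 2) i) atTop (𝓝 (meanReward x i)) := by
      have hp : Tendsto (fun t : ℕ => (1 - c) ^ t) atTop (𝓝 0) :=
        tendsto_pow_atTop_nhds_zero_of_lt_one (by linarith) (by linarith)
      have hdl : ∀ s, Tendsto (fun t => d t s) atTop (𝓝 0) := fun s =>
        squeeze_zero (fun t => hd0 t s) (fun t => by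
          rw [← hds t]
          exact Finset.single_le_sum (fun s _ => hd0 t s) (Finset.mem_univ s)) hp
      unfold meanReward
      refine tendsto_finsetSum _ fun s _ => tendsto_finsetSum _ fun a _ => ?_
      have := ((((tendsto_const_nhds (x := (1 : ℝ))).sub hp).mul_const (x s a)).add
        ((hdl s).div_const 2)).mul_const (reward i s a)
      simpa using this
    -- The shift by one is needed because the average runs over slots 1 to K.
    have hces := ((tendsto_add_atTop_iff_nat 1).2 hlim).cesaro
    refine hces.congr fun K => ?_
    rw [one_div, Finset.range_eq_Ico, Finset.sum_Ico_add' (fun t => meanReward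
        (fun s a => (1 - (1 - c) ^ t) * x s a + d t s / 2) i) 0 K 1]
    rfl


/-! ### Coordinates relative to a favoured queue -/

/-- The state in which the server is at queue `i` iff `f` holds, the channel of queue `i` is `c`,
and the channel of the other queue is `d`. -/
def mkState (i : Fin 2) (f c d : Bool) : State :=
  (if f = true then i else i.rev, fun j => if j = i then c else d)

theorem exists_eq_mkState (i : Fin 2) (s : State) : ∃ f c d, s = mkState i f c d := by
  refine ⟨decide (s.1 = i), s.2 i, s.2 i.rev, Prod.ext ?_ (funext fun j => ?_)⟩
  · have : ∀ m k : Fin 2, m = if decide (m = k) = true then k else k.rev := by decide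
    exact this _ _
  · have : ∀ k j : Fin 2, j = if j = k then k else k.rev := by decide
    simp only [mkState]
    split_ifs with h
    · rw [h]
    · rw [← show j = i.rev by simpa [h] using this i j]

theorem mkState_injective (i : Fin 2) :
    Function.Injective fun q : Bool × Bool × Bool => mkState i q.1 q.2.1 q.2.2 := by
  revert i
  unfold mkState
  decide

theorem sum_state (i : Fin 2) (F : State → ℝ) : ∑ s, F s = ∑ f, ∑ c, ∑ d, F (mkState i f c d) := by
  simp_rw [← Fintype.sum_prod_type']
  refine (Fintype.sum_bijective (fun q : Bool × Bool × Bool => mkState i q.1 q.2.1 q.2.2)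
    ⟨mkState_injective i, fun s => ?_⟩ _ _ fun _ => rfl).symm
  obtain ⟨f, c, d, rfl⟩ := exists_eq_mkState i s
  exact ⟨(f, c, d), rfl⟩

theorem transProb_mkState (ε : ℝ) (i : Fin 2) (f c d : Bool) (a : Action) (f' c' d' : Bool) :
    transProb ε (mkState i f c d) a (mkState i f' c' d') =
      if f' = (f == a) then channelProb ε c c' * channelProb ε d d' else 0 := by
  have h : ((mkState i f' c' d').1 = nextServer (mkState i f c d).1 a) ↔ f' = (f == a) := by
    revert i f c d a f' c' d'
    unfold mkState nextServer
    decide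
  have hp : ∏ j, channelProb ε ((mkState i f c d).2 j) ((mkState i f' c' d').2 j) =
      channelProb ε c c' * channelProb ε d d' := by
    fin_cases i <;> simp [mkState, mul_comm]
  simp only [transProb, h, hp]

theorem reward_mkState (i : Fin 2) (f c d : Bool) (a : Action) :
    reward i (mkState i f c d) a = if (f && a && c) = true then 1 else 0 := by
  have h : ((mkState i f c d).1 = i ∧ a = true ∧ (mkState i f c d).2 i = true) ↔
      (f && a && c) = true := by
    revert i f c d a
    unfold mkState
    decide
  simp only [reward, h]

theorem reward_rev_mkState (i : Fin 2) (f c d : Bool) (a : Action) :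
    reward i.rev (mkState i f c d) a = if (!f && a && d) = true then 1 else 0 := by
  have h : ((mkState i f c d).1 = i.rev ∧ a = true ∧ (mkState i f c d).2 i.rev = true) ↔
      (!f && a && d) = true := by
    revert i f c d a
    unfold mkState
    decide
  simp only [reward, h]

/-- The pair of rates with `p` at queue `i` and `q` at the other queue. -/
def pair (i : Fin 2) (p q : ℝ) : Fin 2 → ℝ := fun j => if j = i then p else q

theorem eq_pair (i : Fin 2) (l : Fin 2 → ℝ) : l = pair i (l i) (l i.rev) := by
  funext j
  fin_cases i <;> fin_cases j <;> simp [pair]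

/-! ### Stationary distributions of deterministic policies -/

/-- The state-action distribution of a stationary deterministic policy `σ` with state
distribution `p`. -/
noncomputable def detOccupation (i : Fin 2) (σ : Bool → Bool → Bool → Bool)
    (p : Bool → Bool → Bool → ℝ) (s : State) (a : Action) : ℝ :=
  if a = σ (decide (s.1 = i)) (s.2 i) (s.2 i.rev)
    then p (decide (s.1 = i)) (s.2 i) (s.2 i.rev) else 0

theorem detOccupation_mkState (i : Fin 2) (σ : Bool → Bool → Bool → Bool)
    (p : Bool → Bool → Bool → ℝ) (f c d : Bool) (a : Action) :
    detOccupation i σ p (mkState i f c d) a = if a = σ f c d then p f c d else 0 := by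
  have h1 : decide ((mkState i f c d).1 = i) = f ∧ (mkState i f c d).2 i = c ∧
      (mkState i f c d).2 i.rev = d := by
    revert i f c d
    unfold mkState
    decide
  simp only [detOccupation, h1.1, h1.2.1, h1.2.2]

/-- Reduces attainment to eight balance equations in coordinates where `f == a` encodes the server
move: staying keeps `f`, switching negates it. -/
theorem pair_mem_stationaryRates {ε : ℝ} (i : Fin 2) (σ : Bool → Bool → Bool → Bool)
    (p : Bool → Bool → Bool → ℝ) (hp : ∀ f c d, 0 ≤ p f c d)
    (hsum : ∑ f, ∑ c, ∑ d, p f c d = 1)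
    (hbal : ∀ f' c' d', p f' c' d' = ∑ f, ∑ c, ∑ d, p f c d *
      if f' = (f == σ f c d) then channelProb ε c c' * channelProb ε d d' else 0)
    {u v : ℝ}
    (hu : u = ∑ f, ∑ c, ∑ d, p f c d * if (f && σ f c d && c) = true then 1 else 0)
    (hv : v = ∑ f, ∑ c, ∑ d, p f c d * if (!f && σ f c d && d) = true then 1 else 0) :
    pair i u v ∈ stationaryRates ε := by
  refine ⟨detOccupation i σ p, ⟨fun s a => ?_, ?_, fun s' => ?_⟩, ?_⟩
  · unfold detOccupation
    split_ifs
    · exact hp _ _ _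
    · exact le_rfl
  · rw [sum_state i]
    simpa only [detOccupation_mkState, Finset.sum_ite_eq', Finset.mem_univ, if_true] using hsum
  · obtain ⟨f', c', d', rfl⟩ := exists_eq_mkState i s'
    rw [sum_state i]
    simpa only [detOccupation_mkState, transProb_mkState, ite_mul, zero_mul,
      Finset.sum_ite_eq', Finset.mem_univ, if_true] using hbal f' c' d'
  · rw [eq_pair i (meanReward _)]
    congr 1
    · rw [hu, meanReward, sum_state i]
      simp only [detOccupation_mkState, reward_mkState, ite_mul, zero_mul,
        Finset.sum_ite_eq', Finset.mem_univ, if_true]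
    · rw [hv, meanReward, sum_state i]
      simp only [detOccupation_mkState, reward_rev_mkState, ite_mul, zero_mul,
        Finset.sum_ite_eq', Finset.mem_univ, if_true]

theorem zero_mem_stationaryRates (ε : ℝ) : 0 ∈ stationaryRates ε := by
  have h : pair 0 0 0 ∈ stationaryRates ε := by
    refine pair_mem_stationaryRates 0 (fun _ _ _ => false) (fun _ _ _ => 1 / 8)
      (fun _ _ _ => by norm_num) (by norm_num) ?_ (by simp) (by simp)
    intro f c d
    cases f <;> cases c <;> cases d <;> simp [channelProb] <;> ring
  convert h using 1
  funext j
  simp [pair]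

/-- Staying at queue `i` forever. -/
theorem half_mem_stationaryRates (ε : ℝ) (i : Fin 2) : pair i (1 / 2) 0 ∈ stationaryRates ε := by
  refine pair_mem_stationaryRates i (fun _ _ _ => true) (fun f _ _ => if f = true then 1 / 4 else 0)
    (fun f _ _ => by split_ifs <;> norm_num) (by norm_num) ?_ (by norm_num) (by simp)
  intro f c d
  cases f <;> cases c <;> cases d <;> simp [channelProb] <;> ring

/-- Being at queue `i` in the next slot unless only the other channel is ON. -/
theorem greedy_mem_stationaryRates {ε : ℝ} (hε0 : 0 < ε) (hε : ε ≤ 1 / 2) (i : Fin 2) :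
    pair i ((2 - ε) / 4) ((1 - ε) ^ 2 / 4) ∈ stationaryRates ε := by
  -- The action `f == target` puts the server at the target. The target depends only on the
  -- channels, so being away from `i` means that the previous channel pair, of probability 1/4, was
  -- (OFF, ON).
  refine pair_mem_stationaryRates i (fun f c d => f == !(!c && d))
    (fun f c d => if f = true then (1 - channelProb ε false c * channelProb ε true d) / 4
      else channelProb ε false c * channelProb ε true d / 4) ?_ ?_ ?_ ?_ ?_
  · intro f c d
    cases f <;> cases c <;> cases d <;> simp [channelProb] <;> nlinarith
  · simp [channelProb]
    ring
  · intro f c d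
    cases f <;> cases c <;> cases d <;> simp [channelProb] <;> ring
  · simp [channelProb]
    ring
  · simp [channelProb]
    ring

/-- Staying if both channels are ON, and otherwise being at queue `i` in the next slot unless only
the other channel is ON. -/
theorem lazy_mem_stationaryRates {ε : ℝ} (hε0 : 0 < ε) (hε : ε ≤ 1 / 2) (i : Fin 2) :
    pair i ((3 - 2 * ε) / (4 * (2 - ε))) ((3 - 2 * ε) * (1 - ε) / (4 * (2 - ε)))
      ∈ stationaryRates ε := by
  obtain ⟨u, hu⟩ : ∃ u, u = 1 / (4 * (2 - ε)) := ⟨_, rfl⟩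
  have hu' : 4 * (2 - ε) * u = 1 := by
    rw [hu]
    exact mul_one_div_cancel (by linarith)
  have hu0 : 0 < u := by
    rw [hu]
    exact one_div_pos.2 (by linarith)
  have hu1 : u ≤ 1 / 4 := by nlinarith
  rw [div_eq_mul_one_div, ← hu, div_eq_mul_one_div ((3 - 2 * ε) * (1 - ε)), ← hu]
  have he : 0 ≤ ε * (1 - ε) := mul_nonneg hε0.le (by linarith)
  have h1 := mul_nonneg he hu0.le
  have h2 := mul_nonneg (sq_nonneg ε) hu0.le
  have h3 := mul_le_mul_of_nonneg_left hu1 he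
  have h4 := mul_le_mul_of_nonneg_left hu1 (sq_nonneg ε)
  -- `q c d` is the mass at queue `i` with channels `(c, d)`. Only the both-ON mass enters its own
  -- balance equations: `u = (1-ε)² u + ε/4` gives `u = 1/(4(2-ε))`, and the other three follow.
  set q : Bool → Bool → ℝ := fun c d => bif c then (bif d then u else u * (ε * (1 - ε)) + (1 - ε) / 4)
    else (bif d then u * (ε * (1 - ε)) + ε / 4 else u * ε ^ 2 + (1 - ε) / 4) with hq
  refine pair_mem_stationaryRates i (fun f c d => f == bif c && d then f else !(!c && d))
    (fun f c d => if f = true then q c d else 1 / 4 - q c d) ?_ ?_ ?_ ?_ ?_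
  · intro f c d
    cases f <;> cases c <;> cases d <;> simp [hq] <;> nlinarith
  · simp [hq]
    ring
  · intro f c d
    cases f <;> cases c <;> cases d <;> simp [channelProb, hq] <;> grind
  · simp [hq]
    grind
  · simp [hq]
    grind

/-! ### Filling triangles -/

/-- Cramer's rule gives the barycentric coordinates of `l` in the triangle with vertices 0, `v`,
`w`; the hypotheses say that they are nonnegative. -/
theorem mem_of_cone {S : Set (Fin 2 → ℝ)} (hS : Convex ℝ S) (h0 : (0 : Fin 2 → ℝ) ∈ S) (i : Fin 2)
    {l : Fin 2 → ℝ} {v₁ v₂ w₁ w₂ : ℝ} (hv : pair i v₁ v₂ ∈ S) (hw : pair i w₁ w₂ ∈ S)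
    (hD : 0 < v₁ * w₂ - v₂ * w₁) (ha : 0 ≤ l i * w₂ - l i.rev * w₁)
    (hb : 0 ≤ v₁ * l i.rev - v₂ * l i)
    (hab : (l i * w₂ - l i.rev * w₁) + (v₁ * l i.rev - v₂ * l i) ≤ v₁ * w₂ - v₂ * w₁) :
    l ∈ S := by
  set D := v₁ * w₂ - v₂ * w₁ with hDdef
  set a := (l i * w₂ - l i.rev * w₁) / D with hadef
  set b := (v₁ * l i.rev - v₂ * l i) / D with hbdef
  have ha' : 0 ≤ a := div_nonneg ha hD.le
  have hb' : 0 ≤ b := div_nonneg hb hD.le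
  have hab' : a + b ≤ 1 := by
    rw [hadef, hbdef, ← add_div]
    exact (div_le_one hD).2 hab
  have haD : a * D = l i * w₂ - l i.rev * w₁ := div_mul_cancel₀ _ hD.ne'
  have hbD : b * D = v₁ * l i.rev - v₂ * l i := div_mul_cancel₀ _ hD.ne'
  have e1 : a * v₁ + b * w₁ = l i := by
    refine mul_right_cancel₀ hD.ne' ?_
    linear_combination v₁ * haD + w₁ * hbD
  have e2 : a * v₂ + b * w₂ = l i.rev := by
    refine mul_right_cancel₀ hD.ne' ?_
    linear_combination v₂ * haD + w₂ * hbD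
  have hmem : a • pair i v₁ v₂ + b • pair i w₁ w₂ + (1 - a - b) • (0 : Fin 2 → ℝ) ∈ S := by
    have := hS.sum_mem (t := Finset.univ) (w := ![a, b, 1 - a - b])
      (z := ![pair i v₁ v₂, pair i w₁ w₂, 0]) ?_ ?_ ?_
    · simpa [Fin.sum_univ_three] using this
    · simpa [Fin.forall_fin_succ] using ⟨ha', hb', by linarith⟩
    · simp [Fin.sum_univ_three]
    · simpa [Fin.forall_fin_succ] using ⟨hv, hw, h0⟩
  convert hmem using 1
  rw [eq_pair i l]
  funext j
  simp only [pair, Pi.add_apply, Pi.smul_apply, smul_eq_mul, Pi.zero_apply, mul_zero, add_zero]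
  split_ifs
  · exact e1.symm
  · exact e2.symm


/-! ### The bounding lines -/

/-- `b` is a bias function in the coordinates of `mkState`, scaled by `w`, for the weights `α` and
`β` and the gain `g`. -/
def IsBias (ε α β g w : ℝ) (b : Bool → Bool → Bool → ℝ) : Prop :=
  ∀ f c d a, w * (α * (if (f && a && c) = true then 1 else 0)
      + β * (if (!f && a && d) = true then 1 else 0) - g)
    + ∑ c', ∑ d', channelProb ε c c' * channelProb ε d d' * b (f == a) c' d' ≤ b f c d

theorem IsBias.rate_le {ε α β g w : ℝ} {b : Bool → Bool → Bool → ℝ}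
    (hb : IsBias ε α β g w b) (hw : 0 < w) (h0 : 0 ≤ ε) (h1 : ε ≤ 1) {μ : State → ℝ}
    (hμ : μ ∈ stdSimplex ℝ State) {r : Fin 2 → ℝ} (hr : r ∈ rateRegion ε μ) (i : Fin 2) :
    α * r i + β * r i.rev ≤ g := by
  obtain ⟨y, hy, hr⟩ := (mem_rateRegion_iff h0 h1 hμ.1 r).1 hr
  refine rate_le_of_bias hμ.2 hy hr i i.rev α β g w hw
    (fun s => b (decide (s.1 = i)) (s.2 i) (s.2 i.rev)) fun s a => ?_
  obtain ⟨f, c, d, rfl⟩ := exists_eq_mkState i s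
  have h : ∀ f c d, decide ((mkState i f c d).1 = i) = f ∧ (mkState i f c d).2 i = c ∧
      (mkState i f c d).2 i.rev = d := by
    revert i
    unfold mkState
    decide
  rw [sum_state i]
  simp only [(h _ _ _).1, (h _ _ _).2.1, (h _ _ _).2.2, reward_mkState, reward_rev_mkState,
    transProb_mkState]
  rw [Finset.sum_eq_single (f == a)]
  · simpa using hb f c d a
  · intro f' _ hf'
    simp [hf']
  · simp

theorem rateRegion_nonneg {ε : ℝ} (h0 : 0 ≤ ε) (h1 : ε ≤ 1) {μ : State → ℝ}
    (hμ : μ ∈ stdSimplex ℝ State) {r : Fin 2 → ℝ} (hr : r ∈ rateRegion ε μ) (i : Fin 2) :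
    0 ≤ r i := by
  obtain ⟨y, hy, hr⟩ := (mem_rateRegion_iff h0 h1 hμ.1 r).1 hr
  exact rate_nonneg hy hr i

/-- Both lazy policies attain this gain, so the inequality is tight on the actions they use. The
scale `w` keeps the bias polynomial. -/
theorem isBias_sum {ε : ℝ} (hε0 : 0 < ε) (hε : ε ≤ 1 / 2) :
    IsBias ε 1 1 (3 / 4 - ε / 2) (8 * ε * (1 - ε)) fun f c d =>
      bif c && d then 4 * (1 - ε) else bif !c && !d then 0 else
      bif f == c then 3 - 4 * ε ^ 2 else 3 - 8 * ε + 4 * ε ^ 2 := by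
  have hk : 0 ≤ 1 - 2 * ε := by linarith
  have p1 : 0 ≤ ε * (1 - ε) * (1 - 2 * ε) := by
    have : 0 ≤ 1 - ε := by linarith
    positivity
  have p2 : 0 ≤ ε * (1 - ε) := by nlinarith
  have p3 : 0 ≤ ε * (1 - ε) * (1 - ε) := by nlinarith
  intro f c d a
  cases f <;> cases c <;> cases d <;> cases a <;> simp [channelProb] <;> nlinarith

/-- The side through the greedy and lazy vertices. Staying at queue `i` when only the other channel
is ON has slack 8ε(1-ε)(1-4ε+2ε²), which is where `hq` enters. -/
theorem isBias_steep {ε : ℝ} (hε0 : 0 < ε) (hε : ε ≤ 1 / 2) (hq : 0 ≤ 1 - 4 * ε + 2 * ε ^ 2) :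
    IsBias ε (1 + ε - ε ^ 2) (1 - ε) (3 / 4 - ε / 2) (8 * ε * (1 - ε)) fun f c d =>
      bif f then
        bif c then (bif d then 4 * (1 - ε) * (1 + ε - ε ^ 2)
          else 3 + 6 * ε - 18 * ε ^ 2 + 8 * ε ^ 3)
        else (bif d then 3 - 14 * ε + 14 * ε ^ 2 - 4 * ε ^ 3 else 0)
      else
        bif c then (bif d then 4 * (1 - ε) * (1 - ε - 3 * ε ^ 2 + 2 * ε ^ 3)
          else 3 - 2 * ε - 18 * ε ^ 2 + 24 * ε ^ 3 - 8 * ε ^ 4)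
        else (bif d then 3 - 6 * ε - 2 * ε ^ 2 + 4 * ε ^ 3 else 0) := by
  have hk : 0 ≤ 1 - 2 * ε := by linarith
  have hw : 0 ≤ ε * (1 - ε) := mul_nonneg hε0.le (by linarith)
  have p0 := mul_nonneg hw hq
  have p1 := mul_nonneg hw (pow_nonneg hε0.le 3)
  have p2 := mul_nonneg hw (mul_nonneg (pow_nonneg hε0.le 2) hk)
  have p3 := mul_nonneg hw (mul_nonneg hε0.le (pow_nonneg hk 2))
  have p4 := mul_nonneg hw (pow_nonneg hk 3)
  intro f c d a
  cases f <;> cases c <;> cases d <;> cases a <;> simp [channelProb] <;> nlinarith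

/-- The side through the staying and greedy vertices. Staying at the other queue when both channels
are ON has slack 2ε(1-4ε+2ε²). -/
theorem isBias_steepest {ε : ℝ} (hε0 : 0 < ε) (hε : ε ≤ 1 / 2)
    (hq : 0 ≤ 1 - 4 * ε + 2 * ε ^ 2) :
    IsBias ε ((1 - ε) ^ 2) ε ((1 - ε) ^ 2 / 2) (2 * ε) fun f c d =>
      bif f then (bif c then (1 - ε) ^ 2 else 0)
      else bif c then 1 - 4 * ε + 5 * ε ^ 2 - 2 * ε ^ 3
      else bif d then 2 * ε ^ 2 else 0 := by
  have hk : 0 ≤ 1 - 2 * ε := by linarith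
  have p0 := mul_nonneg hε0.le hq
  have p1 := mul_nonneg hε0.le (pow_nonneg hε0.le 3)
  have p2 := mul_nonneg hε0.le (mul_nonneg (pow_nonneg hε0.le 2) hk)
  have p3 := mul_nonneg hε0.le (mul_nonneg hε0.le (pow_nonneg hk 2))
  have p4 := mul_nonneg hε0.le (pow_nonneg hk 3)
  intro f c d a
  cases f <;> cases c <;> cases d <;> cases a <;> simp [channelProb] <;> nlinarith

/-- The side through the staying and lazy vertices. Leaving the other queue when both channels are
ON has slack -2(1-4ε+2ε²), hence the reversed `hq`. -/
theorem isBias_critical {ε : ℝ} (hε0 : 0 < ε) (hε : ε ≤ 1 / 2)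
    (hq : 1 - 4 * ε + 2 * ε ^ 2 ≤ 0) :
    IsBias ε ((1 - ε) * (3 - 2 * ε)) 1 ((1 - ε) * (3 - 2 * ε) / 2) (2 * ε) fun f c d =>
      bif f then (bif c then (1 - ε) * (3 - 2 * ε) else 0)
      else bif c then (bif d then 1 - 3 * ε + 8 * ε ^ 2 - 4 * ε ^ 3
        else 3 - 11 * ε + 12 * ε ^ 2 - 4 * ε ^ 3)
      else bif d then 2 * ε else 0 := by
  have hk : 0 ≤ 1 - 2 * ε := by linarith
  -- Cubic Bernstein products in ε and 1 - 2ε, nonnegative on [0, 1/2], offered as hints for the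
  -- slacks.
  have p1 := mul_nonneg hε0.le (pow_nonneg hε0.le 3)
  have p2 := mul_nonneg hε0.le (mul_nonneg (pow_nonneg hε0.le 2) hk)
  have p3 := mul_nonneg hε0.le (mul_nonneg hε0.le (pow_nonneg hk 2))
  have p4 := mul_nonneg hε0.le (pow_nonneg hk 3)
  have p5 := pow_nonneg hk 3
  have p6 := pow_nonneg hε0.le 3
  intro f c d a
  cases f <;> cases c <;> cases d <;> cases a <;> simp [channelProb] <;> nlinarith

/-! ### The regions are filled -/

/-- The triangle spanned by the origin and the two mirror-image lazy vertices. -/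
theorem mem_stationaryRates_middle {ε : ℝ} (hε0 : 0 < ε) (hε : ε ≤ 1 / 2) (i : Fin 2)
    {l : Fin 2 → ℝ} (hl0 : 0 ≤ l i.rev) (hle : l i.rev ≤ l i)
    (hl : (1 - ε) * l i ≤ l i.rev) (hsum : l i + l i.rev ≤ 3 / 4 - ε / 2) :
    l ∈ stationaryRates ε := by
  have hB := lazy_mem_stationaryRates hε0 hε i
  have hB' : pair i ((3 - 2 * ε) * (1 - ε) / (4 * (2 - ε))) ((3 - 2 * ε) / (4 * (2 - ε)))
      ∈ stationaryRates ε := by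
    have h := lazy_mem_stationaryRates hε0 hε i.rev
    rw [eq_pair i (pair i.rev _ _)] at h
    have h1 : i ≠ i.rev := by
      have : ∀ j : Fin 2, j ≠ j.rev := by decide
      exact this i
    simpa [pair, h1] using h
  obtain ⟨k, hk⟩ : ∃ k, k = (3 - 2 * ε) / (4 * (2 - ε)) := ⟨_, rfl⟩
  have hk0 : 0 < k := by rw [hk]; exact div_pos (by linarith) (by linarith)
  have hk' : k * (2 - ε) = 3 / 4 - ε / 2 := by
    have : 2 - ε ≠ 0 := by linarith
    rw [hk]; field_simp; ring
  rw [mul_div_right_comm, ← hk] at hB hB'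
  refine mem_of_cone (convex_stationaryRates ε) (zero_mem_stationaryRates ε) i hB hB' ?_ ?_ ?_ ?_
  · have : 0 < k * k * (ε * (2 - ε)) := by
      have : 0 < 2 - ε := by linarith
      positivity
    linarith
  · have h := mul_nonneg hk0.le (show 0 ≤ l i - (1 - ε) * l i.rev by nlinarith)
    linarith
  · have h := mul_nonneg hk0.le (sub_nonneg.2 hl)
    linarith
  · have h := mul_nonneg (mul_nonneg hk0.le hε0.le)
      (sub_nonneg.2 (hsum.trans hk'.ge))
    linarith

/-- The rays through the lazy vertex (slope 1 - ε) and the greedy vertex (slope (1-ε)²/(2-ε)) cut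
the half where queue `i` dominates into three cones, each bounded by one side. -/
theorem mem_stationaryRates_of_lt {ε : ℝ} (hε0 : 0 < ε) (hε : ε ≤ 1 / 2) (i : Fin 2)
    {l : Fin 2 → ℝ} (hl0 : 0 ≤ l i.rev) (hle : l i.rev ≤ l i)
    (h1 : l i + l i.rev ≤ 3 / 4 - ε / 2)
    (h2 : (1 + ε - ε ^ 2) * l i + (1 - ε) * l i.rev ≤ 3 / 4 - ε / 2)
    (h3 : (1 - ε) ^ 2 * l i + ε * l i.rev ≤ (1 - ε) ^ 2 / 2) : l ∈ stationaryRates ε := by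
  have hS := convex_stationaryRates ε
  have h0 := zero_mem_stationaryRates ε
  have hA := greedy_mem_stationaryRates hε0 hε i
  have hB := lazy_mem_stationaryRates hε0 hε i
  have h1e : 0 < 1 - ε := by linarith
  by_cases hb : (1 - ε) * l i ≤ l i.rev
  · exact mem_stationaryRates_middle hε0 hε i hl0 hle hb h1
  · obtain ⟨k, hk⟩ : ∃ k, k = (3 - 2 * ε) / (4 * (2 - ε)) := ⟨_, rfl⟩
    have hk0 : 0 < k := by rw [hk]; exact div_pos (by linarith) (by linarith)
    have hk' : k * (2 - ε) = 3 / 4 - ε / 2 := by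
      have : 2 - ε ≠ 0 := by linarith
      rw [hk]; field_simp; ring
    rw [mul_div_right_comm, ← hk] at hB
    push Not at hb
    by_cases ha : (1 - ε) ^ 2 * l i ≤ (2 - ε) * l i.rev
    · refine mem_of_cone hS h0 i hA hB ?_ ?_ ?_ ?_
      · have : 0 < k * (1 - ε) := by positivity
        linarith
      · have := mul_nonneg hk0.le (sub_nonneg.2 hb.le)
        linarith
      · linarith
      · refine le_of_mul_le_mul_right ?_ (show 0 < 2 - ε by linarith)
        have h4 := mul_le_mul_of_nonneg_left h2 (show 0 ≤ (1 - ε) / 4 by linarith)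
        linear_combination h4 + (l i * (1 - ε) - l i.rev - (1 - ε) / 4) * hk'
    · push Not at ha
      refine mem_of_cone hS h0 i (half_mem_stationaryRates ε i) hA ?_ ?_ ?_ ?_
      · have : 0 < (1 - ε) ^ 2 := by positivity
        linarith
      · linarith
      · linarith
      · linarith

/-- Here the greedy vertex is not needed: a single triangle joins the staying and lazy vertices. -/
theorem mem_stationaryRates_of_ge {ε : ℝ} (hε0 : 0 < ε) (hε : ε ≤ 1 / 2) (i : Fin 2)
    {l : Fin 2 → ℝ} (hl0 : 0 ≤ l i.rev) (hle : l i.rev ≤ l i)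
    (h1 : l i + l i.rev ≤ 3 / 4 - ε / 2)
    (h2 : (1 - ε) * (3 - 2 * ε) * l i + l i.rev ≤ (1 - ε) * (3 - 2 * ε) / 2) :
    l ∈ stationaryRates ε := by
  have hB := lazy_mem_stationaryRates hε0 hε i
  have h1e : 0 < 1 - ε := by linarith
  by_cases hb : (1 - ε) * l i ≤ l i.rev
  · exact mem_stationaryRates_middle hε0 hε i hl0 hle hb h1
  · obtain ⟨k, hk⟩ : ∃ k, k = (3 - 2 * ε) / (4 * (2 - ε)) := ⟨_, rfl⟩
    have hk0 : 0 < k := by rw [hk]; exact div_pos (by linarith) (by linarith)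
    have hk' : k * (2 - ε) = 3 / 4 - ε / 2 := by
      have : 2 - ε ≠ 0 := by linarith
      rw [hk]; field_simp; ring
    rw [mul_div_right_comm, ← hk] at hB
    push Not at hb
    refine mem_of_cone (convex_stationaryRates ε) (zero_mem_stationaryRates ε) i
      (half_mem_stationaryRates ε i) hB ?_ ?_ ?_ ?_
    · have : 0 < k * (1 - ε) := by positivity
      linarith
    · have := mul_nonneg hk0.le (sub_nonneg.2 hb.le)
      linarith
    · linarith
    · refine le_of_mul_le_mul_right ?_ (show 0 < 2 - ε by linarith)
      linear_combination (1 / 4) * h2 + (l i * (1 - ε) - l i.rev - (1 - ε) / 2) * hk'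

theorem rev_zero_eq : (0 : Fin 2).rev = 1 := rfl

theorem rev_one_eq : (1 : Fin 2).rev = 0 := rfl

theorem quadratic_nonneg_of_lt_criticalEps {ε : ℝ} (h : ε < criticalEps) :
    0 ≤ 1 - 4 * ε + 2 * ε ^ 2 := by
  unfold criticalEps at h
  nlinarith [Real.sq_sqrt (show (0 : ℝ) ≤ 2 by norm_num), Real.sqrt_nonneg 2]

/-- `criticalEps` is the smaller root; the larger one, 1 + √2/2, exceeds 1/2. -/
theorem quadratic_nonpos_of_criticalEps_le {ε : ℝ} (hε : ε ≤ 1 / 2) (h : criticalEps ≤ ε) :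
    1 - 4 * ε + 2 * ε ^ 2 ≤ 0 := by
  unfold criticalEps at h
  nlinarith [Real.sq_sqrt (show (0 : ℝ) ≤ 2 by norm_num), Real.sqrt_nonneg 2]

end SwitchoverQueues

open SwitchoverQueues

theorem mainTheorem1 (ε : ℝ) (hε0 : 0 < ε) (hε : ε ≤ 1 / 2)
    (μ : SwitchoverQueues.State → ℝ) (hμ : μ ∈ stdSimplex ℝ SwitchoverQueues.State) :
    (ε < SwitchoverQueues.criticalEps →
      SwitchoverQueues.rateRegion ε μ =
        {l : Fin 2 → ℝ | 0 ≤ l 0 ∧ 0 ≤ l 1 ∧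
          ε * l 0 + (1 - ε) ^ 2 * l 1 ≤ (1 - ε) ^ 2 / 2 ∧
          (1 - ε) * l 0 + (1 + ε - ε ^ 2) * l 1 ≤ 3 / 4 - ε / 2 ∧
          l 0 + l 1 ≤ 3 / 4 - ε / 2 ∧
          (1 + ε - ε ^ 2) * l 0 + (1 - ε) * l 1 ≤ 3 / 4 - ε / 2 ∧
          (1 - ε) ^ 2 * l 0 + ε * l 1 ≤ (1 - ε) ^ 2 / 2}) ∧
    (SwitchoverQueues.criticalEps ≤ ε →
      SwitchoverQueues.rateRegion ε μ =
        {l : Fin 2 → ℝ | 0 ≤ l 0 ∧ 0 ≤ l 1 ∧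
          l 0 + (1 - ε) * (3 - 2 * ε) * l 1 ≤ (1 - ε) * (3 - 2 * ε) / 2 ∧
          l 0 + l 1 ≤ 3 / 4 - ε / 2 ∧
          (1 - ε) * (3 - 2 * ε) * l 0 + l 1 ≤ (1 - ε) * (3 - 2 * ε) / 2}) := by
  have hε1 : ε ≤ 1 := by linarith
  have hw : 0 < 2 * ε := by linarith
  have hw' : 0 < 8 * ε * (1 - ε) := mul_pos (by linarith) (by linarith)
  refine ⟨fun hc => Set.ext fun l => ⟨fun hl => ?_, fun hl => ?_⟩,
    fun hc => Set.ext fun l => ⟨fun hl => ?_, fun hl => ?_⟩⟩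
  · have hq := quadratic_nonneg_of_lt_criticalEps hc
    have b1 := (isBias_sum hε0 hε).rate_le hw' hε0.le hε1 hμ hl 0
    have b2 := (isBias_steep hε0 hε hq).rate_le hw' hε0.le hε1 hμ hl
    have b3 := (isBias_steepest hε0 hε hq).rate_le hw hε0.le hε1 hμ hl
    have b20 := b2 0
    have b21 := b2 1
    have b30 := b3 0
    have b31 := b3 1
    simp only [rev_zero_eq, rev_one_eq] at b1 b20 b21 b30 b31
    refine ⟨rateRegion_nonneg hε0.le hε1 hμ hl 0, rateRegion_nonneg hε0.le hε1 hμ hl 1, ?_, ?_, ?_,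
      ?_, ?_⟩ <;> linarith
  · obtain ⟨l0, l1, h1, h2, h3, h4, h5⟩ := hl
    refine stationaryRates_subset_rateRegion hε0 hε hμ ?_
    rcases le_total (l 1) (l 0) with h | h
    · exact mem_stationaryRates_of_lt hε0 hε 0 l1 h h3 h4 h5
    · refine mem_stationaryRates_of_lt hε0 hε 1 l0 h ?_ ?_ ?_ <;> rw [rev_one_eq] <;> linarith
  · have hq := quadratic_nonpos_of_criticalEps_le hε hc
    have b1 := (isBias_sum hε0 hε).rate_le hw' hε0.le hε1 hμ hl 0
    have b2 := (isBias_critical hε0 hε hq).rate_le hw hε0.le hε1 hμ hl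
    have b20 := b2 0
    have b21 := b2 1
    simp only [rev_zero_eq, rev_one_eq] at b1 b20 b21
    refine ⟨rateRegion_nonneg hε0.le hε1 hμ hl 0, rateRegion_nonneg hε0.le hε1 hμ hl 1, ?_, ?_,
      ?_⟩ <;> linarith
  · obtain ⟨l0, l1, h1, h2, h3⟩ := hl
    refine stationaryRates_subset_rateRegion hε0 hε hμ ?_
    rcases le_total (l 1) (l 0) with h | h
    · exact mem_stationaryRates_of_ge hε0 hε 0 l1 h h2 h3
    · refine mem_stationaryRates_of_ge hε0 hε 1 l0 h ?_ ?_ <;> rw [rev_one_eq] <;> linarith
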